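/- Let $k\ge 1$ be an odd integer, let $\alpha$ be irrational with continued fraction expansion $\alpha=[a_0;a_1,a_2,\dots]$ and convergents $p_n/q_n$ (so $q_0=1$, $q_1=a_1$), and let $0<\beta<1$. Let $\mathbb S^1=\mathbb R/\mathbb Z$ and let $I$ be the characteristic function of an arc $[c,c+\beta)\bmod 1$ of $\mathbb S^1$ of length $\beta$. Let $X=\mathbb S^1\times \mathbb Z/k\mathbb Z$ carry Lebesgue measure $\mu$ with $\mu(X)=k$, and let $T:X\to X$ be $$T(x,\ell)=\big(x+\alpha \bmod 1,\ \ell+I(x)\bmod k\big).$$ Let $f:X\to\mathbb Z$ take only odd values, satisfy $\int_X f\,d\mu=0$, and be piecewise constant on finitely many intervals (closed on the left, open on the right) on each circle $\mathbb S^1\times\{\ell\}$. Let $T_f(x,\ell,m)=(T(x,\ell),\,m+f(x,\ell))$ be the skew product on $X\times\mathbb Z$, and put $S_m(p)=\sum_{i=0}^{m-1}f(T^i p)$, the $\mathbb Z$-coordinate of $T_f^m(p,0)$. Let $N$ be the number of points of $\mathbb S^1$ that are a discontinuity of $I$ or the projection of a discontinuity of $f$, and put $$\sigma_n(x)=\sum_{i=0}^{q_n-1}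 I\Big(x+\frac{i}{q_n}\bmod 1\Big).$$ An integer $E$ is an essential value of the skew product if for every measurable $A\subset X$ with $\mu(A)>0$ there is an integer $i\ge 0$ with $\mu\big(A\cap T^{-i}A\cap\{p\in X: S_i(p)=E\}\big)>0$. Suppose that for infinitely many $n$ all three of the following hold: $a_{n+1}>k^2N$; $q_n$ is odd; $\sigma_n(x)$ is relatively prime to $k$ for all $x\in\mathbb S^1$. Then the skew product has a finite nonzero essential value, that is, some integer $E\neq 0$ is an essential value. -/

import Mathlib

open Filter MeasureTheory

noncomputable section

namespace CyclicSkew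

/-- The space `S¹ × {0, …, k-1}`, the second factor carrying addition modulo `k`. -/
abbrev Phase (k : ℕ) : Type := UnitAddCircle × ZMod k

/-- Lebesgue measure on `S¹ × {0, …, k-1}`, each of the `k` circles having measure one. -/
def phaseMeasure (k : ℕ) : Measure (Phase k) :=
  (volume : Measure UnitAddCircle).prod Measure.count

/-- The arc of the circle covered by `[c, c + β)`. -/
def arc (c β : ℝ) : Set UnitAddCircle :=
  (fun t : ℝ => (t : UnitAddCircle)) '' Set.Ico c (c + β)

/-- The characteristic function `I` of the arc `[c, c + β)`. -/
def arcInd (c β : ℝ) : UnitAddCircle → ℕ := (arc c β).indicator 1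

/-- The cyclic extension `T (x, ℓ) = (x + α, ℓ + I x)` of the rotation by `α`. -/
def cyclicExt (k : ℕ) (α c β : ℝ) : Phase k → Phase k := fun p =>
  (p.1 + (α : UnitAddCircle), p.2 + (arcInd c β p.1 : ZMod k))

/-- The skew product `T_f (p, m) = (T p, m + f p)` on `X × ℤ`. -/
def skewProduct {X : Type*} (T : X → X) (f : X → ℤ) : X × ℤ → X × ℤ := fun p =>
  (T p.1, p.2 + f p.1)

/-- `S_m p`, the integer coordinate of `T_f ^ m (p, 0)`. -/
def skewSum {X : Type*} (T : X → X) (f : X → ℤ) (m : ℕ) (p : X) : ℤ :=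
  ((skewProduct T f)^[m] (p, 0)).2

theorem skewSum_eq_birkhoffSum {X : Type*} (T : X → X) (f : X → ℤ) (m : ℕ) (p : X) :
    skewSum T f m p = ∑ i ∈ Finset.range m, f (T^[i] p) := by
  have h : (skewProduct T f)^[m] (p, 0) = (T^[m] p, ∑ i ∈ Finset.range m, f (T^[i] p)) := by
    induction m with
    | zero => simp
    | succ m ih =>
      rw [Function.iterate_succ_apply', ih, Function.iterate_succ_apply', Finset.sum_range_succ]
      rfl
  simp only [skewSum, h]

/-- The integer `E` is an essential value of the skew product of `T` by `f`: every measurable set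
`A` of positive measure contains a set of positive measure of points that return to `A`
at some time `i` with `S_i = E`. -/
def IsEssentialValue {X : Type*} [MeasurableSpace X] (μ : Measure X) (T : X → X) (f : X → ℤ)
    (E : ℤ) : Prop :=
  ∀ A : Set X, MeasurableSet A → 0 < μ A →
    ∃ i : ℕ, 0 < μ (A ∩ (T^[i]) ⁻¹' A ∩ {p | skewSum T f i p = E})

/-- `g` is constant on each of finitely many intervals, closed on the left and open on the right,
that partition the circle. -/
def IsStep (g : UnitAddCircle → ℤ) : Prop :=
  ∃ (m : ℕ) (t : ℕ → ℝ), t 0 = 0 ∧ t m = 1 ∧ Monotone t ∧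
    ∀ i < m, ∀ s ∈ Set.Ico (t i) (t (i + 1)), g (s : UnitAddCircle) = g (t i : UnitAddCircle)

/-- The projection to the circle of all discontinuities of `f`, together with the
discontinuities of `I`. -/
def discontinuities (k : ℕ) (c β : ℝ) (f : Phase k → ℤ) : Set UnitAddCircle :=
  {x | ¬ ContinuousAt (arcInd c β) x} ∪ {x | ∃ ℓ : ZMod k, ¬ ContinuousAt (fun y => f (y, ℓ)) x}

/-- `∑_{i < q} I (x + i / q)`; for `q = q_n` this is `σ_n x`. -/
def sigmaSum (c β : ℝ) (q : ℕ) (x : UnitAddCircle) : ℕ :=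
  ∑ i ∈ Finset.range q, arcInd c β (x + (((i : ℝ) / (q : ℝ) : ℝ) : UnitAddCircle))

end CyclicSkew

end

/-! Fix a good `n`, put `q = q_n`, `a = a_{n+1}`, `p = p_n`, and replace the rotation by `α` with
the rotation by `p / q`. Every `q` steps then shift the `ZMod k` coordinate by `σ_n(x)`, a unit mod
`k`, so `k * q` steps visit each point of (coset of `1 / q`) × `ZMod k` exactly once, and the skew
sum is the total of `f` over that set (`sum_periodic_orbit`). This total has an odd number `k * q`
of odd terms, hence is nonzero; as `f` has mean zero and finitely many jumps, it is bounded
independently of `n` (`abs_cosetSum_le`).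

Since `|α - p / q| ≤ 1 / (a q²)`, for all `x` in a set of measure at least `1 / (N k + 1)` the true
orbit follows the periodic one for `k * q` steps without crossing a discontinuity
(`one_div_le_volume_goodSet`, `iterate_and_skewSum_of_mem_goodSet`). Pigeonhole over the bounded set
of totals leaves a subset, still invariant under `1 / q` and of measure bounded below, on which the
skew sum is a constant `E ≠ 0` (`exists_isPartialRigid`); a second pigeonhole over `n` fixes `E`.

Such a set is so evenly spread that it meets any given `A` in almost the expected proportion, and `k
q α` tends to `0` on the circle, so points of `A` in it return to `A` with increment `E`
(`exists_forall_volume_return_pos`). -/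

namespace CyclicSkew

/-! ### Convergents: integrality, coprimality, approximation, growth. -/

open GenContFract in
theorem exists_int_contsAux_eq (α : ℝ) (n : ℕ) :
    ∃ a b : ℤ, ((GenContFract.of α).contsAux n).a = a ∧ ((GenContFract.of α).contsAux n).b = b := by
  induction n using Nat.strong_induction_on with
  | _ n ih =>
    match n with
    | 0 => exact ⟨1, 0, by simp [zeroth_contAux_eq_one_zero], by simp [zeroth_contAux_eq_one_zero]⟩
    | 1 => exact ⟨⌊α⌋, 1, by simp [first_contAux_eq_h_one, of_h_eq_floor],
        by simp [first_contAux_eq_h_one]⟩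
    | n + 2 =>
      obtain ⟨a₀, b₀, ha₀, hb₀⟩ := ih n (by omega)
      obtain ⟨a₁, b₁, ha₁, hb₁⟩ := ih (n + 1) (by omega)
      rcases h : (GenContFract.of α).s.get? n with _ | gp
      · rw [contsAux_stable_step_of_terminated h]
        exact ⟨a₁, b₁, ha₁, hb₁⟩
      · obtain ⟨h1, z, hz⟩ := of_partNum_eq_one_and_exists_int_partDen_eq h
        rw [contsAux_recurrence h rfl rfl, ha₀, hb₀, ha₁, hb₁, h1, hz]
        exact ⟨z * a₁ + a₀, z * b₁ + b₀, by simp, by simp⟩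

theorem not_terminatedAt_of_irrational {α : ℝ} (hα : Irrational α) (n : ℕ) :
    ¬ (GenContFract.of α).TerminatedAt n := by
  intro h
  obtain ⟨r, hr⟩ := GenContFract.exists_rat_eq_of_terminates ⟨n, h⟩
  exact hα ⟨r, hr.symm⟩

theorem exists_coprime_abs_sub_div_le {α : ℝ} (hα : Irrational α) {n a q : ℕ}
    (ha : (GenContFract.of α).partDens.get? n = some (a : ℝ))
    (hq : (GenContFract.of α).dens n = (q : ℝ)) :
    ∃ p : ℤ, IsCoprime p (q : ℤ) ∧ |α - p / q| ≤ 1 / (a * q * q) := by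
  -- `contsAux` is shifted by one: index `n + 1` holds the `n`-th convergent.
  obtain ⟨p, -, hp, -⟩ := exists_int_contsAux_eq α (n + 1)
  obtain ⟨p', q', hp', hq'⟩ := exists_int_contsAux_eq α (n + 2)
  refine ⟨p, ?_, ?_⟩
  · have hdet := SimpContFract.determinant (s := SimpContFract.of α) (n := n)
      (not_terminatedAt_of_irrational hα n)
    change (GenContFract.of α).nums n * (GenContFract.of α).dens (n + 1) -
      (GenContFract.of α).dens n * (GenContFract.of α).nums (n + 1) = (-1) ^ (n + 1) at hdet
    change (GenContFract.of α).nums n = p at hp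
    change (GenContFract.of α).nums (n + 1) = p' at hp'
    change (GenContFract.of α).dens (n + 1) = q' at hq'
    rw [hp, hp', hq', hq] at hdet
    have hdet' : p * q' - (q : ℤ) * p' = (-1) ^ (n + 1) := by exact_mod_cast hdet
    rcases neg_one_pow_eq_or ℤ (n + 1) with h | h
    · exact ⟨q', -p', by linarith⟩
    · exact ⟨-q', p', by linarith⟩
  · have h := GenContFract.abs_sub_convergents_le' ha
    rw [GenContFract.conv_eq_num_div_den, hq] at h
    change (GenContFract.of α).nums n = p at hp
    rwa [hp] at h

theorem tendsto_dens_atTop {α : ℝ} (hα : Irrational α) :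
    Tendsto (GenContFract.of α).dens atTop atTop := by
  have h : ∀ n, ((Nat.fib (n + 1) : ℕ) : ℝ) ≤ (GenContFract.of α).dens n := fun n =>
    GenContFract.succ_nth_fib_le_of_nth_den (Or.inr (not_terminatedAt_of_irrational hα _))
  refine tendsto_atTop_mono h ?_
  refine tendsto_natCast_atTop_atTop.comp ?_
  -- `Nat.fib` is strictly increasing only from index 2 on, so `n + 1` is read as `(n - 1) + 2`,
  -- valid for `n ≥ 1`.
  exact Nat.fib_add_two_strictMono.tendsto_atTop.comp (tendsto_sub_atTop_nat 1) |>.congr' <| by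
    filter_upwards [eventually_ge_atTop 1] with n hn
    simp only [Function.comp]
    congr 1
    omega

/-! ### Step functions on the circle: discontinuities, bounds, measurability. -/

open Topology in
theorem continuousAt_coe_of_eqOn {Y : Type*} [TopologicalSpace Y] {g : UnitAddCircle → Y}
    {U : Set ℝ} (hU : IsOpen U) {s : ℝ} (hs : s ∈ U) {y : Y}
    (h : ∀ t ∈ U, g (t : UnitAddCircle) = y) : ContinuousAt g (s : UnitAddCircle) := by
  have hopen : IsOpen ((fun t : ℝ => (t : UnitAddCircle)) '' U) :=
    QuotientAddGroup.isOpenMap_coe U hU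
  refine (continuousAt_const (y := y)).congr ?_
  filter_upwards [hopen.mem_nhds ⟨s, hs, rfl⟩]
  rintro _ ⟨t, ht, rfl⟩
  exact (h t ht).symm

theorem eq_of_continuousAt_uIcc {Y : Type*} [TopologicalSpace Y] [DiscreteTopology Y]
    {g : UnitAddCircle → Y} {x : UnitAddCircle} {a b : ℝ}
    (h : ∀ s ∈ Set.uIcc a b, ContinuousAt g (x + (s : UnitAddCircle))) :
    g (x + (a : UnitAddCircle)) = g (x + (b : UnitAddCircle)) := by
  have hc : ContinuousOn (fun s : ℝ => g (x + (s : UnitAddCircle))) (Set.uIcc a b) := by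
    intro s hs
    have h1 : ContinuousAt (fun s : ℝ => x + (s : UnitAddCircle)) s :=
      (continuous_const.add (AddCircle.continuous_mk' 1)).continuousAt
    exact (ContinuousAt.comp (f := fun s : ℝ => x + (s : UnitAddCircle)) (h s hs)
      h1).continuousWithinAt
  exact isPreconnected_uIcc.constant hc Set.left_mem_uIcc Set.right_mem_uIcc

theorem exists_coe_eq (x : UnitAddCircle) (a : ℝ) :
    ∃ s ∈ Set.Ico a (a + 1), (s : UnitAddCircle) = x := by
  have h : x ∈ (fun t : ℝ => (t : UnitAddCircle)) '' Set.Ico a (a + 1) := by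
    rw [AddCircle.coe_image_Ico_eq (1 : ℝ) a]; trivial
  exact h

theorem IsStep.exists_partition {g : UnitAddCircle → ℤ} (hg : IsStep g) :
    ∃ (m : ℕ) (t : ℕ → ℝ), ∀ x : UnitAddCircle, ∃ i < m, ∃ s ∈ Set.Ico (t i) (t (i + 1)),
      (s : UnitAddCircle) = x ∧
        ∀ r ∈ Set.Ico (t i) (t (i + 1)), g (r : UnitAddCircle) = g (t i : UnitAddCircle) := by
  obtain ⟨m, t, h0, h1, -, h⟩ := hg
  refine ⟨m, t, fun x => ?_⟩
  obtain ⟨s, ⟨hs0, hs1⟩, rfl⟩ := exists_coe_eq x 0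
  classical
  have hex : ∃ j, s < t j := ⟨m, by rw [h1]; linarith⟩
  have hj := Nat.find_spec hex
  have hjm : Nat.find hex ≤ m := Nat.find_min' hex (by rw [h1]; linarith)
  rcases hi : Nat.find hex with _ | i
  · rw [hi, h0] at hj
    linarith
  · rw [hi] at hj hjm
    have hmin := Nat.find_min hex (m := i) (by omega)
    exact ⟨i, hjm, s, ⟨not_lt.1 hmin, hj⟩, rfl, h i hjm⟩

theorem IsStep.finite_discontinuities {g : UnitAddCircle → ℤ} (hg : IsStep g) :
    {x | ¬ ContinuousAt g x}.Finite := by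
  obtain ⟨m, t, h⟩ := hg.exists_partition
  refine ((Finset.range m).image (fun i => (t i : UnitAddCircle))).finite_toSet.subset ?_
  intro x hx
  obtain ⟨i, hi, s, ⟨hs0, hs1⟩, rfl, hc⟩ := h x
  rcases hs0.eq_or_lt with hs | hs
  · rw [Finset.mem_coe, Finset.mem_image]
    exact ⟨i, Finset.mem_range.2 hi, by rw [hs]⟩
  · exact absurd (continuousAt_coe_of_eqOn isOpen_Ioo ⟨hs, hs1⟩
      (fun r hr => hc r ⟨hr.1.le, hr.2⟩)) hx

theorem IsStep.exists_abs_le {g : UnitAddCircle → ℤ} (hg : IsStep g) :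
    ∃ M : ℤ, ∀ x, |g x| ≤ M := by
  obtain ⟨m, t, h⟩ := hg.exists_partition
  refine ⟨∑ i ∈ Finset.range m, |g (t i : UnitAddCircle)|, fun x => ?_⟩
  obtain ⟨i, hi, s, hs, rfl, hc⟩ := h x
  rw [hc s hs]
  exact Finset.single_le_sum (f := fun i => |g (t i : UnitAddCircle)|)
    (fun _ _ => abs_nonneg _) (Finset.mem_range.2 hi)

/-- A preimage splits into a finite part and its trace on the open set of continuity points, which
is open because the target is discrete. -/
theorem measurable_of_finite_discontinuities {Y : Type*} [TopologicalSpace Y]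
    [DiscreteTopology Y] [MeasurableSpace Y] {g : UnitAddCircle → Y}
    (hg : {x | ¬ ContinuousAt g x}.Finite) : Measurable g := by
  intro S _
  have hsplit : g ⁻¹' S = (g ⁻¹' S ∩ {x | ¬ ContinuousAt g x}) ∪
      (g ⁻¹' S ∩ {x | ¬ ContinuousAt g x}ᶜ) := (Set.inter_union_compl _ _).symm
  rw [hsplit]
  refine (hg.subset Set.inter_subset_right).measurableSet.union (IsOpen.measurableSet ?_)
  have hcont : ContinuousOn g {x | ¬ ContinuousAt g x}ᶜ := fun x hx =>
    (not_not.1 hx : ContinuousAt g x).continuousWithinAt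
  rw [Set.inter_comm]
  exact hcont.isOpen_inter_preimage hg.isClosed.isOpen_compl (isOpen_discrete S)

theorem finite_discontinuities_arcInd (c : ℝ) {β : ℝ} (hβ : β ∈ Set.Ioo (0 : ℝ) 1) :
    {x | ¬ ContinuousAt (arcInd c β) x}.Finite := by
  refine (Set.toFinite {(c : UnitAddCircle), ((c + β : ℝ) : UnitAddCircle)}).subset ?_
  intro x hx
  by_contra hne
  simp only [Set.mem_insert_iff, Set.mem_singleton_iff, not_or] at hne
  obtain ⟨s, ⟨hs0, hs1⟩, rfl⟩ := exists_coe_eq x c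
  have hcs : c < s := lt_of_le_of_ne hs0 (fun h => hne.1 (by rw [h]))
  refine hx ?_
  rcases lt_trichotomy s (c + β) with h | h | h
  · refine continuousAt_coe_of_eqOn (U := Set.Ioo c (c + β)) isOpen_Ioo ⟨hcs, h⟩ (y := 1) ?_
    intro t ht
    have hmem : (t : UnitAddCircle) ∈ arc c β := ⟨t, ⟨ht.1.le, ht.2⟩, rfl⟩
    rw [arcInd, Set.indicator_of_mem hmem]
    rfl
  · exact absurd (by rw [h]) hne.2
  · refine continuousAt_coe_of_eqOn (U := Set.Ioo (c + β) (c + 1)) isOpen_Ioo ⟨h, hs1⟩ (y := 0) ?_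
    intro t ht
    rw [arcInd, Set.indicator_of_notMem]
    rintro ⟨r, hr, hrt⟩
    have hrt' : r = t := (AddCircle.coe_eq_coe_iff_of_mem_Ico (p := (1 : ℝ)) (a := c)
      ⟨hr.1, by linarith [hr.2, hβ.2]⟩ ⟨by linarith [ht.1, hβ.1], ht.2⟩).1 hrt
    rw [hrt'] at hr
    exact absurd hr.2 (not_lt.2 ht.1.le)

theorem finite_discontinuities {k : ℕ} [NeZero k] (c : ℝ) {β : ℝ} (hβ : β ∈ Set.Ioo (0 : ℝ) 1)
    {f : Phase k → ℤ} (hstep : ∀ ℓ : ZMod k, IsStep (fun x => f (x, ℓ))) :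
    (discontinuities k c β f).Finite := by
  refine (finite_discontinuities_arcInd c hβ).union ?_
  rw [Set.ofPred_exists]
  exact Set.finite_iUnion fun ℓ => (hstep ℓ).finite_discontinuities

/-! ### Sums along periodic orbits of the extension. -/

theorem sum_range_mul_eq {M : Type*} [AddCommMonoid M] (g : ℕ → M) (k q : ℕ) :
    ∑ m ∈ Finset.range (k * q), g m =
      ∑ j ∈ Finset.range k, ∑ r ∈ Finset.range q, g (j * q + r) := by
  induction k with
  | zero => simp
  | succ k ih => rw [Nat.succ_mul, Finset.sum_range_add, ih, Finset.sum_range_succ]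

theorem zsmul_eq_toNat_emod_nsmul {A : Type*} [AddCommGroup A] {q : ℕ} (hq : 0 < q) {u : A}
    (hu : q • u = 0) (z : ℤ) : z • u = (z % (q : ℤ)).toNat • u := by
  have h0 : 0 ≤ z % (q : ℤ) := Int.emod_nonneg _ (by exact_mod_cast hq.ne')
  rw [← natCast_zsmul, Int.toNat_of_nonneg h0]
  conv_lhs => rw [← Int.mul_ediv_add_emod z q]
  rw [add_zsmul, mul_comm, mul_zsmul, natCast_zsmul, hu, zsmul_zero, zero_add]

/-- Multiplication by `p` permutes the residues mod `q`; the orbit under `p / q` is thus traded for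
the coset of `1 / q`. -/
theorem sum_zsmul_of_isCoprime {A M : Type*} [AddCommGroup A] [AddCommMonoid M] (h : A → M)
    {q : ℕ} (hq : 0 < q) {u : A} (hu : q • u = 0) {p : ℤ} (hp : IsCoprime p (q : ℤ)) :
    ∑ i ∈ Finset.range q, h (i • p • u) = ∑ i ∈ Finset.range q, h (i • u) := by
  have hq' : (0 : ℤ) < q := by exact_mod_cast hq
  have hmaps : ∀ i ∈ Finset.range q, ((i * p : ℤ) % (q : ℤ)).toNat ∈ Finset.range q := by
    intro i _
    have h1 := Int.emod_lt_of_pos (i * p : ℤ) hq'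
    have h0 := Int.emod_nonneg (i * p : ℤ) hq'.ne'
    rw [Finset.mem_range]
    omega
  have hinj : Set.InjOn (fun i : ℕ => ((i * p : ℤ) % (q : ℤ)).toNat) (Finset.range q) := by
    intro i hi j hj hij
    have hij' : (i * p : ℤ) % (q : ℤ) = (j * p : ℤ) % (q : ℤ) := by
      have h0 := Int.emod_nonneg (i * p : ℤ) hq'.ne'
      have h1 := Int.emod_nonneg (j * p : ℤ) hq'.ne'
      simp only at hij
      omega
    have hd : (q : ℤ) ∣ (j - i) * p := by
      have := Int.ModEq.dvd (show (i * p : ℤ) ≡ j * p [ZMOD q] from hij')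
      rwa [← sub_mul] at this
    have hd' : (q : ℤ) ∣ j - i := hp.symm.dvd_of_dvd_mul_right hd
    simp only [Finset.coe_range, Set.mem_Iio] at hi hj
    have := Int.eq_zero_of_abs_lt_dvd hd' (by rw [abs_lt]; constructor <;> omega)
    omega
  refine Finset.sum_nbij (fun i => ((i * p : ℤ) % (q : ℤ)).toNat) hmaps hinj
    (Finset.surjOn_of_injOn_of_card_le _ hmaps hinj le_rfl) ?_
  intro i _
  rw [← zsmul_eq_toNat_emod_nsmul hq hu, mul_zsmul, natCast_zsmul]

theorem sum_range_natCast_zmod {M : Type*} [AddCommMonoid M] {k : ℕ} [NeZero k] (g : ZMod k → M) :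
    ∑ j ∈ Finset.range k, g (j : ZMod k) = ∑ ℓ, g ℓ := by
  refine Finset.sum_nbij' (fun j => (j : ZMod k)) (fun ℓ => ℓ.val) (fun _ _ => Finset.mem_univ _)
    (fun ℓ _ => Finset.mem_range.2 (ZMod.val_lt ℓ)) ?_ (fun ℓ _ => ZMod.natCast_zmod_val ℓ)
    (fun _ _ => rfl)
  intro j hj
  exact ZMod.val_cast_of_lt (Finset.mem_range.1 hj)

theorem sum_range_add_mul_of_coprime {M : Type*} [AddCommMonoid M] {k : ℕ} [NeZero k]
    (g : ZMod k → M) (ℓ : ZMod k) {s : ℕ} (hs : s.Coprime k) :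
    ∑ j ∈ Finset.range k, g (ℓ + j * s) = ∑ ℓ, g ℓ := by
  rw [sum_range_natCast_zmod (fun z => g (ℓ + z * (s : ZMod k)))]
  have hu : (s : ZMod k) = (ZMod.unitOfCoprime s hs : ZMod k) := rfl
  rw [hu]
  exact Fintype.sum_equiv ((Units.mulRight (ZMod.unitOfCoprime s hs)).trans (Equiv.addLeft ℓ))
    _ _ (fun z => rfl)

/-- The sum of `f` over the fibres of the projection to the circle. -/
def fibreSum {k : ℕ} [NeZero k] (f : Phase k → ℤ) (x : UnitAddCircle) : ℤ := ∑ ℓ, f (x, ℓ)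

theorem cyclicExt_iterate (k : ℕ) (α c β : ℝ) (m : ℕ) (x : UnitAddCircle) (ℓ : ZMod k) :
    (cyclicExt k α c β)^[m] (x, ℓ) =
      (x + m • (α : UnitAddCircle),
        ℓ + (∑ i ∈ Finset.range m, arcInd c β (x + i • (α : UnitAddCircle)) : ℕ)) := by
  induction m with
  | zero => simp
  | succ m ih =>
    rw [Function.iterate_succ_apply', ih, cyclicExt, Finset.sum_range_succ, succ_nsmul,
      Nat.cast_add]
    simp only [add_assoc]

theorem sum_arcInd_add_mul (c β : ℝ) {q : ℕ} {v : UnitAddCircle} (hv : q • v = 0)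
    (x : UnitAddCircle) (j r : ℕ) :
    ∑ i ∈ Finset.range (j * q + r), arcInd c β (x + i • v) =
      j * ∑ i ∈ Finset.range q, arcInd c β (x + i • v) +
        ∑ i ∈ Finset.range r, arcInd c β (x + i • v) := by
  have h : ∀ j i : ℕ, (j * q + i) • v = i • v := fun j i => by
    rw [add_nsmul, mul_nsmul', hv, nsmul_zero, zero_add]
  rw [Finset.sum_range_add, sum_range_mul_eq]
  simp only [h, Finset.sum_const, Finset.card_range, smul_eq_mul]

/-- Write the time as `j * q + r`. For fixed `r` the circle coordinate does not depend on `j`, while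
the second coordinate advances by the same unit with each `j` and so runs once through `ZMod k`. -/
theorem sum_periodic_orbit {k : ℕ} [NeZero k] (c β : ℝ) (f : Phase k → ℤ) {q : ℕ}
    {v : UnitAddCircle} (hv : q • v = 0) {x : UnitAddCircle}
    (hσ : (∑ i ∈ Finset.range q, arcInd c β (x + i • v)).Coprime k) (ℓ : ZMod k) :
    ∑ m ∈ Finset.range (k * q),
        f (x + m • v, ℓ + (∑ i ∈ Finset.range m, arcInd c β (x + i • v) : ℕ)) =
      ∑ r ∈ Finset.range q, fibreSum f (x + r • v) := by
  have h : ∀ j i : ℕ, (j * q + i) • v = i • v := fun j i => by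
    rw [add_nsmul, mul_nsmul', hv, nsmul_zero, zero_add]
  rw [sum_range_mul_eq, Finset.sum_comm]
  refine Finset.sum_congr rfl fun r _ => ?_
  rw [fibreSum, ← sum_range_add_mul_of_coprime (fun ℓ => f (x + r • v, ℓ))
    (ℓ + (∑ i ∈ Finset.range r, arcInd c β (x + i • v) : ℕ)) hσ]
  refine Finset.sum_congr rfl fun j _ => ?_
  rw [h, sum_arcInd_add_mul c β hv]
  congr 2
  push_cast
  ring

/-- If `x` shadows the periodic orbit of `x` under the rotation by `v`, where `q • v = 0`, then
`k * q` steps of the extension add `k * q • α` to `x` and the skew sum is the sum of `fibreSum f`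
over the periodic orbit. -/
theorem iterate_and_skewSum_of_shadow {k : ℕ} [NeZero k] {α c β : ℝ} {f : Phase k → ℤ} {q : ℕ}
    {v : UnitAddCircle} (hv : q • v = 0) {x : UnitAddCircle}
    (hσ : (∑ i ∈ Finset.range q, arcInd c β (x + i • v)).Coprime k)
    (hI : ∀ m < k * q, arcInd c β (x + m • (α : UnitAddCircle)) = arcInd c β (x + m • v))
    (hf : ∀ m < k * q, ∀ ℓ, f (x + m • (α : UnitAddCircle), ℓ) = f (x + m • v, ℓ))
    (ℓ : ZMod k) :
    (cyclicExt k α c β)^[k * q] (x, ℓ) = (x + (k * q) • (α : UnitAddCircle), ℓ) ∧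
      skewSum (cyclicExt k α c β) f (k * q) (x, ℓ) =
        ∑ r ∈ Finset.range q, fibreSum f (x + r • v) := by
  have hs : ∀ m ≤ k * q, ∑ i ∈ Finset.range m, arcInd c β (x + i • (α : UnitAddCircle)) =
      ∑ i ∈ Finset.range m, arcInd c β (x + i • v) := fun m hm =>
    Finset.sum_congr rfl fun i hi => hI i ((Finset.mem_range.1 hi).trans_le hm)
  constructor
  · have h := sum_arcInd_add_mul c β hv x k 0
    rw [add_zero, Finset.range_zero, Finset.sum_empty, add_zero] at h
    rw [cyclicExt_iterate, hs _ le_rfl, h, Nat.cast_mul, ZMod.natCast_self, zero_mul, add_zero]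
  · rw [skewSum_eq_birkhoffSum, ← sum_periodic_orbit c β f hv hσ ℓ]
    refine Finset.sum_congr rfl fun m hm => ?_
    rw [Finset.mem_range] at hm
    rw [cyclicExt_iterate, hf m hm, hs m hm.le]

/-! ### Points whose orbit shadows a rational rotation. -/

/-- The generator `1 / q` of the subgroup of order `q` of the circle. -/
noncomputable def unitFrac (q : ℕ) : UnitAddCircle := ((1 / q : ℝ) : UnitAddCircle)

theorem nsmul_unitFrac_self {q : ℕ} (hq : 0 < q) : q • unitFrac q = 0 := by
  have : (q : ℝ) ≠ 0 := by exact_mod_cast hq.ne'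
  rw [unitFrac, ← AddCircle.coe_nsmul, nsmul_eq_mul, mul_one_div_cancel this]
  exact AddCircle.coe_period 1

theorem sigmaSum_eq (c β : ℝ) (q : ℕ) (x : UnitAddCircle) :
    sigmaSum c β q x = ∑ i ∈ Finset.range q, arcInd c β (x + i • unitFrac q) := by
  refine Finset.sum_congr rfl fun i _ => ?_
  rw [unitFrac, ← AddCircle.coe_nsmul, nsmul_eq_mul, mul_one_div]

theorem norm_coe_le_abs (r : ℝ) : ‖(r : UnitAddCircle)‖ ≤ |r| :=
  QuotientAddGroup.norm_mk_le_norm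

/-- The points `x` such that no arc from `x + i / q` to `x + i / q + r` meets `D`. -/
noncomputable def goodSet (D : Set UnitAddCircle) (q : ℕ) (r : ℝ) : Set UnitAddCircle :=
  {x | ∀ d ∈ D, ∀ i : ℤ, |r| / 2 < ‖x + i • unitFrac q + ((r / 2 : ℝ) : UnitAddCircle) - d‖}

theorem notMem_of_mem_goodSet {D : Set UnitAddCircle} {q : ℕ} {r : ℝ} {x : UnitAddCircle}
    (hx : x ∈ goodSet D q r) (i : ℤ) {s : ℝ} (hs : s ∈ Set.uIcc 0 r) :
    x + i • unitFrac q + (s : UnitAddCircle) ∉ D := by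
  intro hd
  have h := hx _ hd i
  -- Each arc is a closed ball of radius `|r| / 2` about its midpoint, whence the shift by `r / 2`
  -- in `goodSet`; a point `s` of the arc cannot be farther than that from the midpoint.
  rw [add_sub_add_left_eq_sub, ← AddCircle.coe_sub] at h
  have h' : |r| / 2 < |r / 2 - s| := h.trans_le (norm_coe_le_abs _)
  rcases le_total 0 r with hr | hr
  · rw [Set.uIcc_of_le hr] at hs
    rw [abs_of_nonneg hr, lt_abs] at h'
    rcases h' with h' | h' <;> linarith [hs.1, hs.2]
  · rw [Set.uIcc_of_ge hr] at hs
    rw [abs_of_nonpos hr, lt_abs] at h'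
    rcases h' with h' | h' <;> linarith [hs.1, hs.2]

theorem compl_goodSet_eq (D : Set UnitAddCircle) {q : ℕ} (hq : 0 < q) (r : ℝ) :
    (goodSet D q r)ᶜ = ⋃ d ∈ D, ⋃ i ∈ Finset.range q,
      Metric.closedBall (d - i • unitFrac q - ((r / 2 : ℝ) : UnitAddCircle)) (|r| / 2) := by
  have key : ∀ (x d w : UnitAddCircle), x - (d - w - ((r / 2 : ℝ) : UnitAddCircle)) =
      x + w + ((r / 2 : ℝ) : UnitAddCircle) - d := fun x d w => by abel
  ext x
  simp only [goodSet, Set.mem_compl_iff, Set.mem_ofPred_eq, not_forall, not_lt, Set.mem_iUnion,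
    mem_closedBall_iff_norm, key, exists_prop]
  refine exists_congr fun d => and_congr_right fun _ => ⟨?_, ?_⟩
  · rintro ⟨i, hi⟩
    have hq' : (0 : ℤ) < q := by exact_mod_cast hq
    have h1 := Int.emod_lt_of_pos i hq'
    have h0 := Int.emod_nonneg i hq'.ne'
    refine ⟨(i % (q : ℤ)).toNat, Finset.mem_range.2 (by omega), ?_⟩
    rwa [← zsmul_eq_toNat_emod_nsmul hq (nsmul_unitFrac_self hq)]
  · rintro ⟨i, -, hi⟩
    exact ⟨i, by rwa [natCast_zsmul]⟩

theorem measurableSet_goodSet {D : Set UnitAddCircle} (hD : D.Finite) {q : ℕ} (hq : 0 < q)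
    (r : ℝ) : MeasurableSet (goodSet D q r) := by
  rw [← MeasurableSet.compl_iff, compl_goodSet_eq D hq]
  exact hD.measurableSet_biUnion fun d _ => Finset.measurableSet_biUnion _ fun i _ =>
    Metric.isClosed_closedBall.measurableSet

theorem volume_compl_goodSet_le {D : Set UnitAddCircle} (hD : D.Finite) {q : ℕ} (hq : 0 < q)
    (r : ℝ) : volume (goodSet D q r)ᶜ ≤ ENNReal.ofReal (D.ncard * q * |r|) := by
  have hball : ∀ y : UnitAddCircle, volume (Metric.closedBall y (|r| / 2)) ≤
      ENNReal.ofReal |r| := fun y => by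
    rw [AddCircle.volume_closedBall]
    exact ENNReal.ofReal_le_ofReal ((min_le_right _ _).trans (by linarith))
  have hD' : D = ↑hD.toFinset := hD.coe_toFinset.symm
  rw [compl_goodSet_eq D hq, Set.ncard_eq_toFinset_card D hD]
  conv_lhs => rw [hD']
  calc volume (⋃ d ∈ (hD.toFinset : Set UnitAddCircle), ⋃ i ∈ Finset.range q,
        Metric.closedBall (d - i • unitFrac q - ((r / 2 : ℝ) : UnitAddCircle)) (|r| / 2))
      ≤ ∑ d ∈ hD.toFinset, volume (⋃ i ∈ Finset.range q,
        Metric.closedBall (d - i • unitFrac q - ((r / 2 : ℝ) : UnitAddCircle)) (|r| / 2)) :=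
        measure_biUnion_finset_le _ _
    _ ≤ ∑ d ∈ hD.toFinset, ∑ i ∈ Finset.range q, ENNReal.ofReal |r| :=
        Finset.sum_le_sum fun d _ => (measure_biUnion_finset_le _ _).trans
          (Finset.sum_le_sum fun i _ => hball _)
    _ = ENNReal.ofReal (hD.toFinset.card * q * |r|) := by
        rw [Finset.sum_const, Finset.sum_const, Finset.card_range, smul_smul, nsmul_eq_mul,
          ENNReal.ofReal_mul (mul_nonneg (Nat.cast_nonneg _) (Nat.cast_nonneg _)), ← Nat.cast_mul, ENNReal.ofReal_natCast]

theorem add_unitFrac_mem_goodSet_iff {D : Set UnitAddCircle} {q : ℕ} {r : ℝ}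
    {x : UnitAddCircle} : x + unitFrac q ∈ goodSet D q r ↔ x ∈ goodSet D q r := by
  have key : ∀ i : ℤ, x + unitFrac q + i • unitFrac q = x + (i + 1) • unitFrac q := fun i => by
    rw [add_zsmul, one_zsmul]; abel
  simp only [goodSet, Set.mem_ofPred_eq, key]
  refine forall₂_congr fun d _ => ⟨fun h i => ?_, fun h i => h (i + 1)⟩
  simpa using h (i - 1)

/-! ### Uniform bound for sums over cosets, in the manner of Denjoy–Koksma. -/

/-- The sum of `F` over the cosets of the subgroup of order `q` of the circle. -/
noncomputable def cosetSum (F : UnitAddCircle → ℤ) (q : ℕ) (x : UnitAddCircle) : ℤ :=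
  ∑ r ∈ Finset.range q, F (x + r • unitFrac q)

theorem cosetSum_add_unitFrac (F : UnitAddCircle → ℤ) {q : ℕ} (hq : 0 < q) (x : UnitAddCircle) :
    cosetSum F q (x + unitFrac q) = cosetSum F q x := by
  have key : ∀ i : ℕ, x + unitFrac q + i • unitFrac q = x + (i + 1) • unitFrac q := fun i => by
    rw [succ_nsmul]; abel
  have h := Finset.sum_range_succ' (fun r => F (x + r • unitFrac q)) q
  rw [Finset.sum_range_succ, nsmul_unitFrac_self hq, zero_nsmul] at h
  simp only [cosetSum, key]
  exact (add_right_cancel h).symm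

theorem cosetSum_add_nsmul_unitFrac (F : UnitAddCircle → ℤ) {q : ℕ} (hq : 0 < q)
    (x : UnitAddCircle) (i : ℕ) : cosetSum F q (x + i • unitFrac q) = cosetSum F q x := by
  induction i with
  | zero => simp
  | succ i ih => rw [succ_nsmul, ← add_assoc, cosetSum_add_unitFrac F hq, ih]

theorem exists_eq_add_nsmul_unitFrac {q : ℕ} (hq : 0 < q) (x : UnitAddCircle) :
    ∃ s : ℝ, 0 ≤ s ∧ s * q < 1 ∧ ∃ i : ℕ, x = (s : UnitAddCircle) + i • unitFrac q := by
  have hq' : (0 : ℝ) < q := by exact_mod_cast hq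
  obtain ⟨t, ⟨ht0, -⟩, rfl⟩ := exists_coe_eq x 0
  have hfl := Nat.floor_le (a := t * q) (by positivity)
  have hfl' := Nat.lt_floor_add_one (t * q)
  refine ⟨t - ⌊t * q⌋₊ / q, ?_, ?_, ⌊t * q⌋₊, ?_⟩
  · rw [sub_nonneg, div_le_iff₀ hq']
    exact hfl
  · rw [sub_mul, div_mul_cancel₀ _ hq'.ne']
    linarith
  · rw [unitFrac, ← AddCircle.coe_nsmul, ← AddCircle.coe_add, nsmul_eq_mul, mul_one_div,
      sub_add_cancel]

/-- The `i`-th term changes only if the arc of length `s` starting at `x + i / q` meets `D`. As `s <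
1 / q` these arcs are disjoint, so at most `D.ncard` terms change, each by at most `2 * M`. -/
theorem abs_cosetSum_add_sub_le {D : Set UnitAddCircle} (hD : D.Finite) {F : UnitAddCircle → ℤ}
    (hF : ∀ x ∉ D, ContinuousAt F x) {M : ℤ} (hM : ∀ x, |F x| ≤ M) {q : ℕ} (hq : 0 < q)
    (x : UnitAddCircle) {s : ℝ} (hs0 : 0 ≤ s) (hs1 : s * q < 1) :
    |cosetSum F q (x + (s : UnitAddCircle)) - cosetSum F q x| ≤ D.ncard * (2 * M) := by
  classical
  have hq' : (0 : ℝ) < q := by exact_mod_cast hq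
  have hM0 : 0 ≤ M := (abs_nonneg _).trans (hM 0)
  let J := (Finset.range q).filter
    fun i => ∃ r ∈ Set.Icc 0 s, x + i • unitFrac q + (r : UnitAddCircle) ∈ D
  have hterm : ∀ i ∈ Finset.range q, i ∉ J →
      |F (x + (s : UnitAddCircle) + i • unitFrac q) - F (x + i • unitFrac q)| = 0 := by
    intro i hi hiJ
    have h : ∀ r ∈ Set.uIcc 0 s, ContinuousAt F (x + i • unitFrac q + (r : UnitAddCircle)) := by
      intro r hr
      rw [Set.uIcc_of_le hs0] at hr
      exact hF _ fun hd => hiJ (Finset.mem_filter.2 ⟨hi, r, hr, hd⟩)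
    have h' := eq_of_continuousAt_uIcc h
    rw [AddCircle.coe_zero, add_zero] at h'
    rw [add_right_comm, ← h', sub_self, abs_zero]
  have hcard : J.card ≤ D.ncard := by
    have hex : ∀ i ∈ J, ∃ r ∈ Set.Icc 0 s, x + i • unitFrac q + (r : UnitAddCircle) ∈ D :=
      fun i hi => (Finset.mem_filter.1 hi).2
    choose! r hr hrD using hex
    rw [Set.ncard_eq_toFinset_card D hD]
    refine Finset.card_le_card_of_injOn
      (fun i => x + i • unitFrac q + (r i : UnitAddCircle))
      (fun i hi => by simpa using hrD i hi) ?_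
    have hbd : ∀ i ∈ J, ((i / q + r i : ℝ)) ∈ Set.Ico (0 : ℝ) (0 + 1) ∧
        r i * q < 1 ∧ 0 ≤ r i * q := by
      intro i hi
      have hiq : ((i : ℝ) + 1) ≤ q := by
        exact_mod_cast Finset.mem_range.1 (Finset.mem_filter.1 hi).1
      have h0 := (hr i hi).1
      have h1 : r i * q < 1 := (mul_le_mul_of_nonneg_right (hr i hi).2 hq'.le).trans_lt hs1
      refine ⟨⟨by positivity, ?_⟩, h1, by positivity⟩
      rw [zero_add, ← mul_lt_mul_iff_left₀ hq', add_mul, div_mul_cancel₀ _ hq'.ne']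
      linarith
    intro i hi j hj hij
    have hi' := hbd i hi
    have hj' := hbd j hj
    simp only [add_assoc, add_right_inj, unitFrac, ← AddCircle.coe_nsmul, ← AddCircle.coe_add,
      nsmul_eq_mul, mul_one_div] at hij
    have heq := (AddCircle.coe_eq_coe_iff_of_mem_Ico (p := (1 : ℝ)) hi'.1 hj'.1).1 hij
    have heq' : (i : ℝ) + r i * q = j + r j * q := by
      have := congrArg (· * (q : ℝ)) heq
      simpa [add_mul, div_mul_cancel₀ _ hq'.ne'] using this
    have h1 : (i : ℝ) < j + 1 := by linarith [hi'.2.1, hi'.2.2, hj'.2.1, hj'.2.2]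
    have h2 : (j : ℝ) < i + 1 := by linarith [hi'.2.1, hi'.2.2, hj'.2.1, hj'.2.2]
    have h1' : i < j + 1 := by exact_mod_cast h1
    have h2' : j < i + 1 := by exact_mod_cast h2
    omega
  calc |cosetSum F q (x + (s : UnitAddCircle)) - cosetSum F q x|
      ≤ ∑ i ∈ Finset.range q,
          |F (x + (s : UnitAddCircle) + i • unitFrac q) - F (x + i • unitFrac q)| := by
        rw [cosetSum, cosetSum, ← Finset.sum_sub_distrib]
        exact Finset.abs_sum_le_sum_abs _ _
    _ = ∑ i ∈ J, |F (x + (s : UnitAddCircle) + i • unitFrac q) - F (x + i • unitFrac q)| :=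
        (Finset.sum_subset (Finset.filter_subset _ _) hterm).symm
    _ ≤ ∑ i ∈ J, 2 * M := Finset.sum_le_sum fun i _ => by
        have := abs_sub (F (x + (s : UnitAddCircle) + i • unitFrac q)) (F (x + i • unitFrac q))
        linarith [hM (x + (s : UnitAddCircle) + i • unitFrac q), hM (x + i • unitFrac q)]
    _ ≤ D.ncard * (2 * M) := by
        rw [Finset.sum_const, nsmul_eq_mul]
        have : (J.card : ℤ) ≤ D.ncard := by exact_mod_cast hcard
        exact mul_le_mul_of_nonneg_right this (by linarith)

theorem abs_cosetSum_sub_le {D : Set UnitAddCircle} (hD : D.Finite) {F : UnitAddCircle → ℤ}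
    (hF : ∀ x ∉ D, ContinuousAt F x) {M : ℤ} (hM : ∀ x, |F x| ≤ M) {q : ℕ} (hq : 0 < q)
    (x y : UnitAddCircle) : |cosetSum F q y - cosetSum F q x| ≤ D.ncard * (2 * M) := by
  obtain ⟨s, hs0, hs1, i, hi⟩ := exists_eq_add_nsmul_unitFrac hq (y - x)
  have hy : y = x + (s : UnitAddCircle) + i • unitFrac q := by
    rw [add_assoc, ← hi]; abel
  rw [hy, cosetSum_add_nsmul_unitFrac F hq]
  exact abs_cosetSum_add_sub_le hD hF hM hq x hs0 hs1

theorem integral_cosetSum {F : UnitAddCircle → ℤ} (hF : Integrable (fun x => (F x : ℝ)) volume)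
    (q : ℕ) : Integrable (fun x => (cosetSum F q x : ℝ)) volume ∧
      ∫ x, (cosetSum F q x : ℝ) = q * ∫ x, (F x : ℝ) := by
  have hi : ∀ r : ℕ, Integrable (fun x => (F (x + r • unitFrac q) : ℝ)) volume := fun r =>
    hF.comp_add_right (r • unitFrac q)
  simp only [cosetSum, Int.cast_sum]
  refine ⟨integrable_finsetSum _ fun r _ => hi r, ?_⟩
  rw [integral_finsetSum _ fun r _ => hi r]
  simp only [integral_add_right_eq_self (fun x => (F x : ℝ)), Finset.sum_const,
    Finset.card_range, nsmul_eq_mul]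

/-- With mean zero the sum takes a value `≤ 0` and a value `≥ 0`, so the bound on its oscillation
bounds the sum itself. -/
theorem abs_cosetSum_le {D : Set UnitAddCircle} (hD : D.Finite) {F : UnitAddCircle → ℤ}
    (hF : ∀ x ∉ D, ContinuousAt F x) {M : ℤ} (hM : ∀ x, |F x| ≤ M)
    (hint : Integrable (fun x => (F x : ℝ)) volume) (hmean : ∫ x, (F x : ℝ) = 0)
    {q : ℕ} (hq : 0 < q) (x : UnitAddCircle) : |cosetSum F q x| ≤ D.ncard * (2 * M) := by
  obtain ⟨hi, h0⟩ := integral_cosetSum hint q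
  rw [hmean, mul_zero] at h0
  -- A positive integer is at least `1`, so positivity everywhere would force the integral to be at
  -- least `1`.
  obtain ⟨y, hy⟩ : ∃ y, cosetSum F q y ≤ 0 := by
    by_contra! h
    have h1 : ∫ _ : UnitAddCircle, (1 : ℝ) ≤ ∫ x, (cosetSum F q x : ℝ) :=
      integral_mono (integrable_const _) hi fun x => by
        have := h x
        change (1 : ℝ) ≤ (cosetSum F q x : ℝ)
        exact_mod_cast this
    rw [h0] at h1
    norm_num [Measure.real, UnitAddCircle.measure_univ] at h1
  obtain ⟨z, hz⟩ : ∃ z, 0 ≤ cosetSum F q z := by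
    by_contra! h
    have h1 : ∫ x, (cosetSum F q x : ℝ) ≤ ∫ _ : UnitAddCircle, (-1 : ℝ) :=
      integral_mono hi (integrable_const _) fun x => by
        have := h x
        have h2 : ((cosetSum F q x : ℤ) : ℝ) ≤ ((-1 : ℤ) : ℝ) :=
          Int.cast_le.2 (by omega)
        simpa using h2
    rw [h0] at h1
    norm_num [Measure.real, UnitAddCircle.measure_univ] at h1
  have h1 := abs_le.1 (abs_cosetSum_sub_le hD hF hM hq y x)
  have h2 := abs_le.1 (abs_cosetSum_sub_le hD hF hM hq z x)
  exact abs_le.2 ⟨by linarith, by linarith⟩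

/-! ### Near independence of periodic sets and positive-measure returns. -/

open Topology symmDiff in
theorem tendsto_volume_translate_symmDiff {A : Set UnitAddCircle} (hA : MeasurableSet A) :
    Tendsto (fun t : UnitAddCircle => volume ({x | x + t ∈ A} ∆ A)) (𝓝 0) (𝓝 0) := by
  let F : C(UnitAddCircle, C(UnitAddCircle, UnitAddCircle)) :=
    ContinuousMap.curry ⟨fun p => p.2 + p.1, by fun_prop⟩
  have hF : ∀ t, MeasurePreserving (F t) volume volume := fun t =>
    measurePreserving_add_right volume t
  have h := tendsto_measure_symmDiff_preimage_nhds_zero (l := 𝓝 (0 : UnitAddCircle)) (f := F)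
    (g := F 0) (s := A) (F.continuous.tendsto 0) (Eventually.of_forall hF) (hF 0)
    hA.nullMeasurableSet (measure_ne_top volume A)
  have h0 : F 0 ⁻¹' A = A := by
    ext x
    change x + 0 ∈ A ↔ x ∈ A
    rw [add_zero]
  rw [h0] at h
  exact h

theorem lintegral_volume_inter_translate {A B : Set UnitAddCircle}
    (hB : MeasurableSet B) :
    ∫⁻ t : UnitAddCircle, volume (A ∩ {x | x + t ∈ B}) = volume A * volume B := by
  have h1 : ∀ t : UnitAddCircle, volume (A ∩ {x | x + t ∈ B}) =
      ∫⁻ x in A, B.indicator 1 (x + t) := by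
    intro t
    have hm : MeasurableSet {x : UnitAddCircle | x + t ∈ B} := measurable_add_const t hB
    rw [show (fun x => B.indicator (1 : UnitAddCircle → ENNReal) (x + t)) =
      {x : UnitAddCircle | x + t ∈ B}.indicator 1 from rfl, lintegral_indicator_one hm,
      Measure.restrict_apply hm, Set.inter_comm]
  have h2 : ∀ x : UnitAddCircle, ∫⁻ t : UnitAddCircle, B.indicator 1 (x + t) = volume B := by
    intro x
    rw [lintegral_add_left_eq_self (fun t => B.indicator (1 : UnitAddCircle → ENNReal) t) x,
      lintegral_indicator_one hB]
  simp only [h1]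
  rw [lintegral_lintegral_swap]
  · simp only [h2, lintegral_const, Measure.restrict_apply_univ, mul_comm]
  · have : Measurable (fun p : UnitAddCircle × UnitAddCircle =>
        B.indicator (1 : UnitAddCircle → ENNReal) (p.2 + p.1)) :=
      (measurable_one.indicator hB).comp (measurable_snd.add measurable_fst)
    exact this.aemeasurable

open symmDiff in
/-- A set invariant under the rotation by `1 / q` is almost independent of a set that is almost
invariant under rotations by at most `1 / q`. -/
theorem volume_mul_volume_le_of_periodic {A B : Set UnitAddCircle} (hA : MeasurableSet A)
    (hB : MeasurableSet B) {q : ℕ} (hq : 0 < q) (hper : ∀ x, x + unitFrac q ∈ B ↔ x ∈ B)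
    {ε : ENNReal}
    (hε : ∀ s : ℝ, 0 ≤ s → s * q < 1 → volume ({x | x + (-s : UnitAddCircle) ∈ A} ∆ A) ≤ ε) :
    volume A * volume B ≤ volume (A ∩ B) + ε := by
  have hper' : ∀ (i : ℕ) x, x + i • unitFrac q ∈ B ↔ x ∈ B := by
    intro i x
    induction i with
    | zero => simp
    | succ i ih => rw [succ_nsmul, ← add_assoc, hper, ih]
  -- The average over `t` of the right-hand side is the left-hand side, so some `t` does at least as
  -- well.
  obtain ⟨t, ht⟩ : ∃ t : UnitAddCircle, volume A * volume B ≤ volume (A ∩ {x | x + t ∈ B}) := by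
    rw [← lintegral_volume_inter_translate hB]
    have : IsProbabilityMeasure (volume : Measure UnitAddCircle) := ⟨UnitAddCircle.measure_univ⟩
    exact exists_lintegral_le (by
      rw [lintegral_volume_inter_translate hB]
      exact ENNReal.mul_ne_top (measure_ne_top _ _) (measure_ne_top _ _))
  -- Periodicity of `B` reduces `t` to `0 ≤ s < 1 / q`; the small translation is then moved from `B`
  -- to `A`.
  obtain ⟨s, hs0, hs1, i, rfl⟩ := exists_eq_add_nsmul_unitFrac hq t
  have h1 : A ∩ {x | x + ((s : UnitAddCircle) + i • unitFrac q) ∈ B} =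
      (fun x => x + (s : UnitAddCircle)) ⁻¹' ({x | x + (-s : UnitAddCircle) ∈ A} ∩ B) := by
    ext x
    simp only [Set.mem_inter_iff, Set.mem_ofPred_eq, Set.mem_preimage, ← add_assoc, hper',
      add_neg_cancel_right]
  have hm : MeasurableSet ({x : UnitAddCircle | x + (-s : UnitAddCircle) ∈ A} ∩ B) :=
    (measurable_add_const _ hA).inter hB
  rw [h1, (measurePreserving_add_right volume _).measure_preimage hm.nullMeasurableSet] at ht
  calc volume A * volume B ≤ volume ({x | x + (-s : UnitAddCircle) ∈ A} ∩ B) := ht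
    _ ≤ volume (A ∩ B ∪ {x | x + (-s : UnitAddCircle) ∈ A} ∆ A) := by
        refine measure_mono fun x hx => ?_
        by_cases hxA : x ∈ A
        · exact Or.inl ⟨hxA, hx.2⟩
        · exact Or.inr (Or.inl ⟨hx.1, hxA⟩)
    _ ≤ volume (A ∩ B) + ε := (measure_union_le _ _).trans (by gcongr; exact hε s hs0 hs1)

-- The point is uniformity: `η` depends on `A` and `δ` only, so it can be chosen before `q`, `t` and
-- `B`.
open symmDiff in
theorem exists_forall_volume_return_pos {A : Set UnitAddCircle} (hA : MeasurableSet A)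
    (hpos : 0 < volume A) {δ : ENNReal} (hδ : 0 < δ) :
    ∃ η : ℝ, 0 < η ∧ ∀ q : ℕ, 1 / η < q → ∀ t : UnitAddCircle, ‖t‖ < η →
      ∀ B : Set UnitAddCircle, MeasurableSet B → (∀ x, x + unitFrac q ∈ B ↔ x ∈ B) →
        δ ≤ volume B → 0 < volume (A ∩ {x | x + t ∈ A} ∩ B) := by
  wlog hδ1 : δ ≤ 1 generalizing δ
  · obtain ⟨η, hη, h⟩ := this (δ := 1) one_pos le_rfl
    exact ⟨η, hη, fun q hq t ht B hB hper hv => h q hq t ht B hB hper ((le_of_not_ge hδ1).trans hv)⟩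
  have hδtop : δ ≠ ⊤ := ne_top_of_le_ne_top ENNReal.one_ne_top hδ1
  -- One third is lost to the failure of independence and one to the translation by `t`; the last
  -- keeps the measure positive.
  set ε : ENNReal := volume A * δ / 3 with hε
  have hAδ : volume A * δ ≠ ⊤ := ENNReal.mul_ne_top (measure_ne_top _ _) hδtop
  have hε0 : 0 < ε := ENNReal.div_pos (ENNReal.mul_pos hpos.ne' hδ.ne').ne' (by norm_num)
  have hεtop : ε ≠ ⊤ := ENNReal.div_ne_top hAδ (by norm_num)
  have hε3 : volume A * δ = ε + ε + ε := by
    rw [hε, ENNReal.add_thirds]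
  obtain ⟨η, hη, hball⟩ := Metric.eventually_nhds_iff.1
    ((tendsto_volume_translate_symmDiff hA).eventually (gt_mem_nhds hε0))
  refine ⟨η, hη, fun q hq t ht B hB hper hv => ?_⟩
  have hq0 : (0 : ℝ) < q := (by positivity : 0 < 1 / η).trans hq
  have hBε := volume_mul_volume_le_of_periodic hA hB (by exact_mod_cast hq0) hper (ε := ε)
    fun s hs0 hs1 => by
      refine (hball ?_).le
      rw [dist_zero_right, norm_neg]
      refine (norm_coe_le_abs s).trans_lt ?_
      rw [abs_of_nonneg hs0]
      rw [div_lt_iff₀ hη] at hq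
      by_contra! hle
      nlinarith
  have htA : volume ({x | x + t ∈ A} ∆ A) < ε := hball (by rwa [dist_zero_right])
  have hAB : volume (A ∩ B) ≤ volume (A ∩ {x | x + t ∈ A} ∩ B) + ε := by
    calc volume (A ∩ B) ≤ volume (A ∩ {x | x + t ∈ A} ∩ B ∪ {x | x + t ∈ A} ∆ A) := by
          refine measure_mono fun x hx => ?_
          by_cases hxA : x + t ∈ A
          · exact Or.inl ⟨⟨hx.1, hxA⟩, hx.2⟩
          · exact Or.inr (Or.inr ⟨hx.1, hxA⟩)
      _ ≤ _ := (measure_union_le _ _).trans (by gcongr)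
  rw [pos_iff_ne_zero]
  intro h0
  rw [h0, zero_add] at hAB
  have hle : ε + ε + ε ≤ ε + ε := by
    calc ε + ε + ε = volume A * δ := hε3.symm
      _ ≤ volume A * volume B := by gcongr
      _ ≤ volume (A ∩ B) + ε := hBε
      _ ≤ ε + ε := by gcongr
  exact (ENNReal.lt_add_right (ENNReal.add_ne_top.2 ⟨hεtop, hεtop⟩) hε0.ne').not_ge hle

/-! ### Sums of `f` over fibres: bound, mean, continuity, parity. -/

theorem exists_forall_abs_le {k : ℕ} [NeZero k] {f : Phase k → ℤ}
    (hstep : ∀ ℓ : ZMod k, IsStep (fun x => f (x, ℓ))) : ∃ M : ℤ, ∀ p, |f p| ≤ M := by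
  choose M hM using fun ℓ => (hstep ℓ).exists_abs_le
  refine ⟨∑ ℓ, M ℓ, fun p => (hM p.2 p.1).trans ?_⟩
  exact Finset.single_le_sum (f := M) (fun ℓ _ => (abs_nonneg _).trans (hM ℓ 0))
    (Finset.mem_univ p.2)

theorem measurable_of_isStep {k : ℕ} {f : Phase k → ℤ}
    (hstep : ∀ ℓ : ZMod k, IsStep (fun x => f (x, ℓ))) [NeZero k] : Measurable f :=
  measurable_from_prod_countable_left fun ℓ =>
    measurable_of_finite_discontinuities (hstep ℓ).finite_discontinuities

theorem integrable_of_isStep {k : ℕ} [NeZero k] {f : Phase k → ℤ}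
    (hstep : ∀ ℓ : ZMod k, IsStep (fun x => f (x, ℓ))) :
    Integrable (fun p => (f p : ℝ)) ((volume : Measure UnitAddCircle).prod Measure.count) := by
  obtain ⟨M, hM⟩ := exists_forall_abs_le hstep
  refine Integrable.of_bound
    (measurable_from_top.comp (measurable_of_isStep hstep)).aestronglyMeasurable (M : ℝ) ?_
  refine Eventually.of_forall fun p => ?_
  rw [Real.norm_eq_abs]
  exact_mod_cast hM p

theorem integrable_fibreSum {k : ℕ} [NeZero k] {f : Phase k → ℤ}
    (hstep : ∀ ℓ : ZMod k, IsStep (fun x => f (x, ℓ))) :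
    Integrable (fun x => (fibreSum f x : ℝ)) volume := by
  have h := (integrable_of_isStep hstep).integral_prod_left
  simpa only [integral_count, fibreSum, Int.cast_sum] using h

theorem integral_fibreSum {k : ℕ} [NeZero k] {f : Phase k → ℤ}
    (hstep : ∀ ℓ : ZMod k, IsStep (fun x => f (x, ℓ))) :
    ∫ x, (fibreSum f x : ℝ) = ∫ p, (f p : ℝ) ∂(phaseMeasure k) := by
  rw [phaseMeasure, integral_prod _ (integrable_of_isStep hstep)]
  simp only [integral_count, fibreSum, Int.cast_sum]

theorem abs_fibreSum_le {k : ℕ} [NeZero k] {f : Phase k → ℤ} {M : ℤ} (hM : ∀ p, |f p| ≤ M)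
    (x : UnitAddCircle) : |fibreSum f x| ≤ k * M := by
  calc |fibreSum f x| ≤ ∑ ℓ, |f (x, ℓ)| := Finset.abs_sum_le_sum_abs _ _
    _ ≤ ∑ _ℓ : ZMod k, M := Finset.sum_le_sum fun ℓ _ => hM _
    _ = k * M := by simp [ZMod.card]

theorem continuousAt_fibreSum {k : ℕ} [NeZero k] {c β : ℝ} {f : Phase k → ℤ} {x : UnitAddCircle}
    (hx : x ∉ discontinuities k c β f) : ContinuousAt (fibreSum f) x := by
  have h : ∀ ℓ : ZMod k, ContinuousAt (fun y => f (y, ℓ)) x := by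
    intro ℓ
    by_contra hc
    exact hx (Or.inr ⟨ℓ, hc⟩)
  exact tendsto_finsetSum _ fun ℓ _ => h ℓ

theorem odd_sum_of_odd_card {ι : Type*} {s : Finset ι} {g : ι → ℤ} (hs : Odd s.card)
    (hg : ∀ i ∈ s, Odd (g i)) : Odd (∑ i ∈ s, g i) := by
  have h : ((∑ i ∈ s, g i : ℤ) : ZMod 2) = (s.card : ZMod 2) := by
    rw [Int.cast_sum, Finset.sum_congr rfl fun i hi => ZMod.intCast_eq_one_iff_odd.2 (hg i hi)]
    simp
  rw [← ZMod.intCast_eq_one_iff_odd, h]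
  exact ZMod.natCast_eq_one_iff_odd.2 hs

theorem odd_cosetSum_fibreSum {k q : ℕ} [NeZero k] {f : Phase k → ℤ} (hk : Odd k) (hq : Odd q)
    (hodd : ∀ p, Odd (f p)) (x : UnitAddCircle) : Odd (cosetSum (fibreSum f) q x) := by
  refine odd_sum_of_odd_card (by simpa using hq) fun r _ =>
    odd_sum_of_odd_card (by simpa [ZMod.card] using hk) fun ℓ _ => hodd _

/-! ### Partially rigid sets with constant nonzero skew sum. -/

theorem one_div_le_volume_goodSet {D : Set UnitAddCircle} (hD : D.Finite) {k a q : ℕ}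
    (hk : 0 < k) (hq : 0 < q) (ha : k ^ 2 * D.ncard < a) {θ : ℝ} (hθ : |θ| ≤ 1 / (a * q * q)) :
    ENNReal.ofReal (1 / (D.ncard * k + 1)) ≤ volume (goodSet D q (k * q * θ)) := by
  have hq' : (0 : ℝ) < q := by exact_mod_cast hq
  have ha0 : (0 : ℝ) < a := by exact_mod_cast (Nat.zero_le _).trans_lt ha
  have haN : (D.ncard * k + 1 : ℝ) ≤ a := by
    -- Only `k * N < a` is needed here; it follows from `k ≤ k ^ 2`.
    have h : D.ncard * k + 1 ≤ a := by nlinarith [Nat.zero_le D.ncard]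
    exact_mod_cast h
  have hr : (D.ncard * q * |k * q * θ| : ℝ) ≤ D.ncard * k / (D.ncard * k + 1) := by
    have h1 : q * q * |θ| ≤ 1 / a := by
      calc q * q * |θ| ≤ q * q * (1 / (a * q * q)) := by gcongr
        _ = 1 / a := by field_simp
    calc (D.ncard * q * |k * q * θ| : ℝ) = D.ncard * k * (q * q * |θ|) := by
          rw [abs_mul, abs_of_nonneg (by positivity : (0 : ℝ) ≤ k * q)]; ring
      _ ≤ D.ncard * k * (1 / a) := by gcongr
      _ ≤ D.ncard * k * (1 / (D.ncard * k + 1)) := by gcongr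
      _ = _ := by ring
  have hc := (volume_compl_goodSet_le hD hq (k * q * θ)).trans (ENNReal.ofReal_le_ofReal hr)
  have h1 : volume (goodSet D q (k * q * θ)) + volume (goodSet D q (k * q * θ))ᶜ = 1 := by
    rw [measure_add_measure_compl (measurableSet_goodSet hD hq _), UnitAddCircle.measure_univ]
  have h2 : ENNReal.ofReal (1 / (D.ncard * k + 1)) +
      ENNReal.ofReal (D.ncard * k / (D.ncard * k + 1)) = 1 := by
    rw [← ENNReal.ofReal_add (by positivity) (by positivity), ← ENNReal.ofReal_one]
    congr 1
    field_simp
    ring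
  rw [← h1] at h2
  refine (ENNReal.add_le_add_iff_right (ENNReal.ofReal_ne_top (r := D.ncard * k /
    (D.ncard * k + 1)))).1 ?_
  rw [h2]
  gcongr

theorem iterate_and_skewSum_of_mem_goodSet {k : ℕ} [NeZero k] {α c β : ℝ} {f : Phase k → ℤ}
    {q : ℕ} (hq : 0 < q) {p : ℤ} (hp : IsCoprime p (q : ℤ)) {x : UnitAddCircle}
    (hx : x ∈ goodSet (discontinuities k c β f) q (k * q * (α - p / q)))
    (hσ : (sigmaSum c β q x).Coprime k) (ℓ : ZMod k) :
    (cyclicExt k α c β)^[k * q] (x, ℓ) = (x + (k * q) • (α : UnitAddCircle), ℓ) ∧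
      skewSum (cyclicExt k α c β) f (k * q) (x, ℓ) = cosetSum (fibreSum f) q x := by
  have hq' : (0 : ℝ) < q := by exact_mod_cast hq
  have hu := nsmul_unitFrac_self hq
  set r : ℝ := k * q * (α - p / q) with hr
  have hv : q • p • unitFrac q = 0 := by rw [smul_comm, hu, smul_zero]
  -- At time `m` the two orbits differ by `m * (α - p / q)`, which lies between `0` and `r`, so the
  -- arc joining them avoids the discontinuities. General `Y` serves both `arcInd` and `f`.
  have hshadow : ∀ {Y : Type} [TopologicalSpace Y] [DiscreteTopology Y] (g : UnitAddCircle → Y),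
      (∀ y ∉ discontinuities k c β f, ContinuousAt g y) → ∀ m < k * q,
        g (x + m • (α : UnitAddCircle)) = g (x + m • p • unitFrac q) := by
    intro Y _ _ g hg m hm
    have hmr : m * (α - p / q) ∈ Set.uIcc 0 r := by
      have hm' : (m : ℝ) ≤ k * q := by exact_mod_cast hm.le
      have hm0 : (0 : ℝ) ≤ m := Nat.cast_nonneg m
      rw [hr]
      rcases le_total 0 (α - p / q) with h | h
      · rw [Set.uIcc_of_le (by positivity)]
        exact ⟨by positivity, by gcongr⟩
      · rw [Set.uIcc_of_ge (mul_nonpos_of_nonneg_of_nonpos (by positivity) h)]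
        exact ⟨mul_le_mul_of_nonpos_right hm' h, mul_nonpos_of_nonneg_of_nonpos hm0 h⟩
    have h := eq_of_continuousAt_uIcc (g := g) (x := x + m • p • unitFrac q) (a := 0)
      (b := m * (α - p / q)) fun s hs => by
        refine hg _ ?_
        have := notMem_of_mem_goodSet hx (m * p) (Set.uIcc_subset_uIcc Set.left_mem_uIcc hmr hs)
        rwa [mul_zsmul, natCast_zsmul] at this
    rw [AddCircle.coe_zero, add_zero] at h
    rw [h, add_assoc]
    congr 2
    rw [unitFrac, ← AddCircle.coe_zsmul, ← AddCircle.coe_nsmul, ← AddCircle.coe_nsmul,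
      ← AddCircle.coe_add]
    congr 1
    simp only [nsmul_eq_mul, zsmul_eq_mul]
    ring
  have h := iterate_and_skewSum_of_shadow (α := α) (f := f) hv (x := x)
    (by
      rw [sum_zsmul_of_isCoprime (fun y => arcInd c β (x + y)) hq hu hp, ← sigmaSum_eq]
      exact hσ)
    (hshadow (arcInd c β) fun y hy => by
      by_contra hc
      exact hy (Or.inl hc))
    (fun m hm ℓ => hshadow (fun y => f (y, ℓ)) (fun y hy => by
      by_contra hc
      exact hy (Or.inr ⟨ℓ, hc⟩)) m hm) ℓ
  refine ⟨h.1, h.2.trans ?_⟩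
  exact sum_zsmul_of_isCoprime (fun y => fibreSum f (x + y)) hq hu hp

theorem norm_nsmul_coe_le {α : ℝ} {k a q : ℕ} (ha : 0 < a) (hq : 0 < q) {p : ℤ}
    (h : |α - p / q| ≤ 1 / (a * q * q)) : ‖(k * q) • (α : UnitAddCircle)‖ ≤ k / q := by
  have hq' : (0 : ℝ) < q := by exact_mod_cast hq
  have ha' : (1 : ℝ) ≤ a := by exact_mod_cast ha
  have heq : (k * q) • (α : UnitAddCircle) = ((k * q * (α - p / q) : ℝ) : UnitAddCircle) := by
    -- Subtracting the integer `k * p` leaves only the error `k * q * (α - p / q)`.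
    have h0 : (((k * p : ℤ) : ℝ) : UnitAddCircle) = 0 := by
      rw [AddCircle.coe_eq_zero_iff]
      exact ⟨k * p, by simp⟩
    rw [← AddCircle.coe_nsmul, nsmul_eq_mul, ← sub_eq_zero, ← AddCircle.coe_sub, ← h0]
    congr 1
    push_cast
    field_simp
    ring
  rw [heq]
  refine (norm_coe_le_abs _).trans ?_
  rw [abs_mul, abs_of_nonneg (by positivity : (0 : ℝ) ≤ k * q)]
  calc (k * q * |α - p / q| : ℝ) ≤ k * q * (1 / (a * q * q)) := by gcongr
    _ = k / q * (1 / a) := by field_simp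
    _ ≤ k / q * 1 := by
        gcongr
        rw [div_le_one (by linarith)]
        exact ha'
    _ = k / q := mul_one _

/-- `B` is a set, invariant under the rotation by `1 / q` and of measure at least `δ`, over which
`k * q` steps of the skew product rotate the circle by little, fix the second coordinate and
change the integer coordinate by `E`. -/
structure IsPartialRigid (k : ℕ) (α c β : ℝ) (f : Phase k → ℤ) (δ : ENNReal) (q : ℕ) (E : ℤ)
    (B : Set UnitAddCircle) : Prop where
  measurableSet : MeasurableSet B
  periodic : ∀ x, x + unitFrac q ∈ B ↔ x ∈ B
  le_volume : δ ≤ volume B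
  norm_le : ‖(k * q) • (α : UnitAddCircle)‖ ≤ k / q
  iterate : ∀ x ∈ B, ∀ ℓ : ZMod k,
    (cyclicExt k α c β)^[k * q] (x, ℓ) = (x + (k * q) • (α : UnitAddCircle), ℓ)
  skewSum_eq : ∀ x ∈ B, ∀ ℓ : ZMod k, skewSum (cyclicExt k α c β) f (k * q) (x, ℓ) = E

/-- `S` and `δ` are chosen before `n`; this uniformity allows one `E` to serve infinitely many `n`.
-/
theorem exists_isPartialRigid {k : ℕ} (hk : Odd k) {α c β : ℝ} (hα : Irrational α)
    (hβ : β ∈ Set.Ioo (0 : ℝ) 1) {f : Phase k → ℤ}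
    (hstep : ∀ ℓ : ZMod k, IsStep (fun x => f (x, ℓ))) (hodd : ∀ p, Odd (f p))
    (hmean : ∫ p, (f p : ℝ) ∂(phaseMeasure k) = 0) :
    ∃ (S : Finset ℤ) (δ : ENNReal), 0 < δ ∧ ∀ n a q : ℕ,
      (GenContFract.of α).partDens.get? n = some (a : ℝ) →
      (GenContFract.of α).dens n = (q : ℝ) →
      k ^ 2 * (discontinuities k c β f).ncard < a → Odd q →
      (∀ x : UnitAddCircle, (sigmaSum c β q x).Coprime k) →
      ∃ E ∈ S, E ≠ 0 ∧ ∃ B, IsPartialRigid k α c β f δ q E B := by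
  have : NeZero k := ⟨hk.pos.ne'⟩
  have hD := finite_discontinuities c hβ hstep
  obtain ⟨M, hM⟩ := exists_forall_abs_le hstep
  set D := discontinuities k c β f with hDdef
  set C : ℤ := D.ncard * (2 * (k * M)) with hC
  have hM0 : 0 ≤ M := (abs_nonneg _).trans (hM 0)
  have hC0 : 0 ≤ C := by positivity
  have hS : (Finset.Icc (-C) C).Nonempty := ⟨0, by simp [hC0]⟩
  set δ₀ := ENNReal.ofReal (1 / (D.ncard * k + 1)) with hδ₀
  have hδ₀pos : 0 < δ₀ := ENNReal.ofReal_pos.2 (by positivity)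
  refine ⟨Finset.Icc (-C) C, δ₀ / (Finset.Icc (-C) C).card,
    ENNReal.div_pos hδ₀pos.ne' (ENNReal.natCast_ne_top _), ?_⟩
  intro n a q ha hqn haN hq hσ
  have hq0 : 0 < q := hq.pos
  obtain ⟨p, hp, hpα⟩ := exists_coprime_abs_sub_div_le hα ha hqn
  set G := goodSet D q (k * q * (α - p / q)) with hG
  have hGvol : δ₀ ≤ volume G := one_div_le_volume_goodSet hD hk.pos hq0 haN hpα
  have hGm : MeasurableSet G := measurableSet_goodSet hD hq0 _
  have hΦ : ∀ x, |cosetSum (fibreSum f) q x| ≤ C := fun x =>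
    abs_cosetSum_le hD (fun x hx => continuousAt_fibreSum hx) (abs_fibreSum_le hM)
      (integrable_fibreSum hstep) ((integral_fibreSum hstep).trans hmean) hq0 x
  have hF : Measurable (fibreSum f) := measurable_of_finite_discontinuities
    (hD.subset fun x hx => by
      by_contra hxD
      exact hx (continuousAt_fibreSum hxD))
  have hΦm : Measurable (cosetSum (fibreSum f) q) :=
    Finset.measurable_fun_sum _ fun r _ => hF.comp (measurable_add_const _)
  have hcover : volume G ≤ ∑ E ∈ Finset.Icc (-C) C,
      volume (G ∩ {x | cosetSum (fibreSum f) q x = E}) := by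
    refine (measure_mono fun x hx => ?_).trans (measure_biUnion_finset_le _ _)
    rw [Set.mem_iUnion₂]
    exact ⟨_, Finset.mem_Icc.2 (abs_le.1 (hΦ x)), hx, rfl⟩
  -- Pigeonhole: the at most `2 * C + 1` level sets cover `G`, so one has at least the average share
  -- of `δ₀`.
  obtain ⟨E, hE, hEvol⟩ : ∃ E ∈ Finset.Icc (-C) C, δ₀ / (Finset.Icc (-C) C).card ≤
      volume (G ∩ {x | cosetSum (fibreSum f) q x = E}) := by
    by_contra! h
    have hlt := ENNReal.sum_lt_sum_of_nonempty hS h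
    rw [Finset.sum_const, nsmul_eq_mul, ENNReal.mul_div_cancel
      (by exact_mod_cast hS.card_pos.ne') (ENNReal.natCast_ne_top _)] at hlt
    exact (hGvol.trans hcover).not_gt hlt
  -- A point of the level set is needed to read off that `E` is odd.
  obtain ⟨x₀, -, hx₀⟩ : (G ∩ {x | cosetSum (fibreSum f) q x = E}).Nonempty :=
    nonempty_of_measure_ne_zero ((ENNReal.div_pos hδ₀pos.ne'
      (ENNReal.natCast_ne_top _)).trans_le hEvol).ne'
  refine ⟨E, hE, ?_, G ∩ {x | cosetSum (fibreSum f) q x = E},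
    hGm.inter (hΦm (measurableSet_singleton E)), fun x => ?_, hEvol,
    norm_nsmul_coe_le ((Nat.zero_le _).trans_lt haN) hq0 hpα, fun x hx ℓ => ?_, fun x hx ℓ => ?_⟩
  · rintro rfl
    have hEo := odd_cosetSum_fibreSum hk hq hodd x₀
    rw [show cosetSum (fibreSum f) q x₀ = 0 from hx₀] at hEo
    exact absurd hEo (by decide)
  · exact and_congr add_unitFrac_mem_goodSet_iff
      (by rw [Set.mem_ofPred_eq, Set.mem_ofPred_eq, cosetSum_add_unitFrac _ hq0])
  · exact (iterate_and_skewSum_of_mem_goodSet hq0 hp hx.1 (hσ x) ℓ).1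
  · exact (iterate_and_skewSum_of_mem_goodSet hq0 hp hx.1 (hσ x) ℓ).2.trans hx.2

/-! ### From rigid sets to essential values. -/

theorem exists_slice_volume_pos {k : ℕ} [NeZero k] {A : Set (Phase k)}
    (hpos : 0 < phaseMeasure k A) : ∃ ℓ : ZMod k, 0 < volume {x : UnitAddCircle | (x, ℓ) ∈ A} := by
  by_contra! h
  refine hpos.ne' (le_antisymm ?_ zero_le)
  have hsub : A ⊆ ⋃ ℓ : ZMod k, {x : UnitAddCircle | (x, ℓ) ∈ A} ×ˢ {ℓ} := by
    rintro ⟨x, ℓ⟩ hx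
    exact Set.mem_iUnion.2 ⟨ℓ, hx, rfl⟩
  refine (measure_mono hsub).trans ((measure_iUnion_le _).trans ?_)
  refine (ENNReal.tsum_eq_zero.2 fun ℓ => ?_).le
  rw [phaseMeasure, Measure.prod_prod, le_antisymm (h ℓ) zero_le, zero_mul]

theorem isEssentialValue_of_frequently {k : ℕ} [NeZero k] {α c β : ℝ} {f : Phase k → ℤ}
    {δ : ENNReal} (hδ : 0 < δ) {E : ℤ} (h : ∀ K : ℝ, ∃ q : ℕ, K < q ∧
      ∃ B, IsPartialRigid k α c β f δ q E B) :
    IsEssentialValue (phaseMeasure k) (cyclicExt k α c β) f E := by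
  intro A hA hpos
  obtain ⟨ℓ, hℓ⟩ := exists_slice_volume_pos hpos
  have hAℓ : MeasurableSet {x : UnitAddCircle | (x, ℓ) ∈ A} := measurable_prodMk_right hA
  obtain ⟨η, hη, hret⟩ := exists_forall_volume_return_pos hAℓ hℓ hδ
  -- The term `k / η` makes the displacement, at most `k / q`, smaller than `η`; the term `1 / η`
  -- makes the period `1 / q` smaller than `η`.
  obtain ⟨q, hq, B, hB⟩ := h (k / η + 1 / η)
  have hk0 : (0 : ℝ) ≤ k / η := by positivity
  have h1 : (0 : ℝ) < 1 / η := by positivity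
  have hq0 : (0 : ℝ) < q := by linarith
  have hnorm : ‖(k * q) • (α : UnitAddCircle)‖ < η := by
    refine hB.norm_le.trans_lt ?_
    rw [div_lt_iff₀ hq0, ← div_lt_iff₀' hη]
    linarith
  have hvol := hret q (by linarith) _ hnorm B hB.measurableSet hB.periodic hB.le_volume
  refine ⟨k * q, ?_⟩
  refine lt_of_lt_of_le ?_ (measure_mono (μ := phaseMeasure k) (s := ({x : UnitAddCircle |
    (x, ℓ) ∈ A} ∩ {x | x + (k * q) • (α : UnitAddCircle) ∈ {x | (x, ℓ) ∈ A}} ∩ B) ×ˢ {ℓ}) ?_)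
  · rw [phaseMeasure, Measure.prod_prod, Measure.count_singleton, mul_one]
    exact hvol
  · rintro ⟨x, ℓ'⟩ ⟨⟨⟨hx, hxt⟩, hxB⟩, rfl⟩
    refine ⟨⟨hx, ?_⟩, hB.skewSum_eq x hxB _⟩
    rw [Set.mem_preimage, hB.iterate x hxB]
    exact hxt

end CyclicSkew

theorem mainTheorem3 (k : ℕ) (hk : Odd k) (α c β : ℝ) (hα : Irrational α)
    (hβ : β ∈ Set.Ioo (0 : ℝ) 1) (f : CyclicSkew.Phase k → ℤ)
    (hstep : ∀ ℓ : ZMod k, CyclicSkew.IsStep (fun x => f (x, ℓ)))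
    (hodd : ∀ p, Odd (f p))
    (hmean : ∫ p, (f p : ℝ) ∂(CyclicSkew.phaseMeasure k) = 0)
    (hinf : ∃ᶠ n in atTop, ∃ a q : ℕ,
      -- `a` is the partial quotient `a_{n+1}` and `q` the convergent denominator `q_n` of `α`
      (GenContFract.of α).partDens.get? n = some (a : ℝ) ∧
      (GenContFract.of α).dens n = (q : ℝ) ∧
      k ^ 2 * (CyclicSkew.discontinuities k c β f).ncard < a ∧
      Odd q ∧
      ∀ x : UnitAddCircle, (CyclicSkew.sigmaSum c β q x).Coprime k) :
    ∃ E : ℤ, E ≠ 0 ∧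
      CyclicSkew.IsEssentialValue (CyclicSkew.phaseMeasure k)
        (CyclicSkew.cyclicExt k α c β) f E := by
  have : NeZero k := ⟨hk.pos.ne'⟩
  obtain ⟨S, δ, hδ, hS⟩ := CyclicSkew.exists_isPartialRigid hk hα hβ hstep hodd hmean
  -- If each `E` in the finite set `S` failed for all large `n`, all would fail together at some
  -- good `n`.
  obtain ⟨E, -, hE⟩ : ∃ E ∈ S, ∃ᶠ n in atTop, E ≠ 0 ∧ ∃ q : ℕ,
      (GenContFract.of α).dens n = (q : ℝ) ∧
        ∃ B, CyclicSkew.IsPartialRigid k α c β f δ q E B := by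
    by_contra h
    obtain ⟨n, ⟨a, q, ha, hq, haN, hqo, hσ⟩, hn⟩ :=
      (hinf.and_eventually ((eventually_all_finset S).2 fun E hE =>
        not_frequently.1 fun hc => h ⟨E, hE, hc⟩)).exists
    obtain ⟨E, hES, hE0, B, hB⟩ := hS n a q ha hq haN hqo hσ
    exact hn E hES ⟨hE0, q, hq, B, hB⟩
  refine ⟨E, hE.exists.choose_spec.1, CyclicSkew.isEssentialValue_of_frequently hδ fun K => ?_⟩
  obtain ⟨n, ⟨-, q, hq, hB⟩, hK⟩ := (hE.and_eventually
    ((CyclicSkew.tendsto_dens_atTop hα).eventually_gt_atTop K)).exists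
  exact ⟨q, hq ▸ hK, hB⟩
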